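/- All Hilbert spaces are complex, $\mathbb T$ is the unit circle and $\mathbb D$ the open unit disk. Let $H$ be a separable Hilbert space and let $T(\lambda)=T_0+\lambda T_1$ be a linear pencil of bounded operators on $H$ such that $T(\lambda)$ is a contraction for every $\lambda\in\mathbb T$. Definitions. For a separable Hilbert space $X$, $H^2_X(\mathbb D)$ is the space of holomorphic $x:\mathbb D\to X$ with $\|x\|^2=\frac1{2\pi}\sup_{0<r<1}\int_0^{2\pi}\|x(re^{is})\|^2\,ds<\infty$. A holomorphic function $\theta$ on $\mathbb D$ whose values are contractions from $X$ to $Y$ is outer if $\theta H^2_X(\mathbb D)$ is dense in $H^2_Y(\mathbb D)$. A linear pencil $S(\lambda)=S_0+\lambda S_1$ on a Hilbert space $K\supseteq H$ is a dilation of $T(\lambda)$ if $T(\lambda)^n=P_H S(\lambda)^n|_H$ for all $\lambda\in\mathbb T$, $n\ge 0$; it is a uniform dilation if, moreover, $T(\lambda_1)\cdots T(\lambda_n)=P_H S(\lambda_1)\cdots S(\lambda_n)|_H$ for all $n$ and all $\lambda_1,\dots,\lambda_n\in\mathbb T$; it is an isometric (resp. uniform isometric) dilation if, in addition, $S(\lambda)$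 is an isometry for every $\lambda\in\mathbb T$. An isometric (resp. uniform isometric) dilation $S(\lambda)$ of $T(\lambda)$ on $K$ is minimal if the only closed subspace $L$ with $H\subseteq L\subseteq K$ for which the compression $P_L S(\lambda)|_L$ is again an isometric (resp. uniform isometric) dilation of $T(\lambda)$ is $L=K$. Theorem. (1) There exist a separable Hilbert space $Y$ and a linear outer function $F(z)=F_0+zF_1$ with values bounded operators from $H$ to $Y$ such that $$F(\lambda)^*F(\lambda)=I_H-T(\lambda)^*T(\lambda)\qquad(\lambda\in\mathbb T).$$ (2) For every such $Y$ and $F$, let $K_+=\bigl(\bigoplus_{k=-\infty}^{-1}Y\bigr)\oplus H$, where $H$ is identified with the last summand, and let $$V(\lambda)\,\mathrm{col}(\dots,y_{-2},y_{-1},h)=\mathrm{col}(\dots,y_{-2},y_{-1},F(\lambda)h,T(\lambda)h),$$ so that the component of index $-1$ of the image is $F(\lambda)h$, the component of index $-(k+1)$ is $y_{-k}$ for $k\ge1$, and the component in $H$ is $T(\lambda)h$. Then the linear pencil $V(\lambda)$ is a minimal isometric dilation of $T(\lambda)$, and it is also a minimal uniform isometric dilation of $T(\lambda)$. -/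

import Mathlib

open scoped ENNReal
open ContinuousLinearMap

universe u v w

noncomputable section

/-! ### Linear pencils of operators -/

/-- A linear pencil `A(z) = A₀ + z A₁` of bounded operators from `E` to `F`. -/
structure LinearPencil (E : Type u) (F : Type v)
    [NormedAddCommGroup E] [InnerProductSpace ℂ E]
    [NormedAddCommGroup F] [InnerProductSpace ℂ F] where
  /-- The constant coefficient `A₀`. -/
  coeff0 : E →L[ℂ] F
  /-- The linear coefficient `A₁`. -/
  coeff1 : E →L[ℂ] F

namespace LinearPencil

/-- The value `A(z) = A₀ + z A₁`. -/
def eval {E : Type u} {F : Type v}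
    [NormedAddCommGroup E] [InnerProductSpace ℂ E]
    [NormedAddCommGroup F] [InnerProductSpace ℂ F]
    (A : LinearPencil E F) (z : ℂ) : E →L[ℂ] F :=
  A.coeff0 + z • A.coeff1

/-- `A(ζ)` is a contraction for every `ζ` on the unit circle. -/
def IsContractive {E : Type u} [NormedAddCommGroup E] [InnerProductSpace ℂ E]
    (A : LinearPencil E E) : Prop :=
  ∀ ζ : ℂ, ‖ζ‖ = 1 → ‖A.eval ζ‖ ≤ 1

/-- `A(ζ)` is an isometry for every `ζ` on the unit circle. -/
def IsIsometric {E : Type u} [NormedAddCommGroup E] [InnerProductSpace ℂ E]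
    (A : LinearPencil E E) : Prop :=
  ∀ ζ : ℂ, ‖ζ‖ = 1 → ∀ x : E, ‖A.eval ζ x‖ = ‖x‖

/-- The compression `P_L A(z)|L` of a pencil on `K` to a closed subspace `L` of `K`. -/
def compress {K : Type w} [NormedAddCommGroup K] [InnerProductSpace ℂ K]
    (A : LinearPencil K K) (L : Submodule ℂ K) [CompleteSpace L] : LinearPencil L L where
  coeff0 := L.orthogonalProjectionOnto ∘L A.coeff0 ∘L L.subtypeL
  coeff1 := L.orthogonalProjectionOnto ∘L A.coeff1 ∘L L.subtypeL

end LinearPencil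

/-! ### Dilations

The inclusion `H ⊆ K` of Hilbert spaces is given by a linear isometry `ι : H → K`; then the
adjoint of `ι` is the orthogonal projection of `K` onto `H`. -/

section Dilations

variable {H : Type u} [NormedAddCommGroup H] [InnerProductSpace ℂ H] [CompleteSpace H]
  {K : Type w} [NormedAddCommGroup K] [InnerProductSpace ℂ K] [CompleteSpace K]

/-- `S` is a dilation of `T`: `T(ζ)ⁿ = P_H S(ζ)ⁿ|H` for all `|ζ| = 1` and `n ≥ 0`. -/
def IsDilation (ι : H →ₗᵢ[ℂ] K) (T : LinearPencil H H) (S : LinearPencil K K) : Prop :=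
  ∀ ζ : ℂ, ‖ζ‖ = 1 → ∀ n : ℕ,
    T.eval ζ ^ n =
      adjoint ι.toContinuousLinearMap ∘L (S.eval ζ ^ n) ∘L ι.toContinuousLinearMap

/-- `S` is a uniform dilation of `T`: it is a dilation, and
`T(ζ₁)⋯T(ζₙ) = P_H S(ζ₁)⋯S(ζₙ)|H` for every finite list `ζ₁, …, ζₙ` in the unit circle. -/
def IsUniformDilation (ι : H →ₗᵢ[ℂ] K) (T : LinearPencil H H) (S : LinearPencil K K) : Prop :=
  IsDilation ι T S ∧
  ∀ l : List ℂ, (∀ ζ ∈ l, ‖ζ‖ = 1) →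
    (l.map T.eval).prod =
      adjoint ι.toContinuousLinearMap ∘L (l.map S.eval).prod ∘L ι.toContinuousLinearMap

/-- `S` is an isometric dilation of the contractive pencil `T`. -/
def IsIsometricDilation (ι : H →ₗᵢ[ℂ] K) (T : LinearPencil H H) (S : LinearPencil K K) : Prop :=
  T.IsContractive ∧ S.IsIsometric ∧ IsDilation ι T S

/-- `S` is a uniform isometric dilation of the contractive pencil `T`. -/
def IsUniformIsometricDilation (ι : H →ₗᵢ[ℂ] K) (T : LinearPencil H H)
    (S : LinearPencil K K) : Prop :=
  T.IsContractive ∧ S.IsIsometric ∧ IsUniformDilation ι T S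

/-- `S` is minimal among the isometric dilations of `T`: no compression of `S` to a proper closed
subspace `L ⊇ H` is an isometric dilation of `T`. (Any pencil on `L` that has `S` as a dilation is
the compression of `S` to `L`.) -/
def IsMinimalIsometricDilation (ι : H →ₗᵢ[ℂ] K) (T : LinearPencil H H)
    (S : LinearPencil K K) : Prop :=
  IsIsometricDilation ι T S ∧
  ∀ (L : Submodule ℂ K) [CompleteSpace L] (κ : H →ₗᵢ[ℂ] L), (∀ h : H, (κ h : K) = ι h) →
    IsIsometricDilation κ T (S.compress L) → L = ⊤

/-- `S` is minimal among the uniform isometric dilations of `T`: no compression of `S` to a proper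
closed subspace `L ⊇ H` is a uniform isometric dilation of `T`. -/
def IsMinimalUniformIsometricDilation (ι : H →ₗᵢ[ℂ] K) (T : LinearPencil H H)
    (S : LinearPencil K K) : Prop :=
  IsUniformIsometricDilation ι T S ∧
  ∀ (L : Submodule ℂ K) [CompleteSpace L] (κ : H →ₗᵢ[ℂ] L), (∀ h : H, (κ h : K) = ι h) →
    IsUniformIsometricDilation κ T (S.compress L) → L = ⊤

end Dilations

/-! ### Hardy space and outer functions -/

/-- The squared Hardy norm `(2π)⁻¹ sup_{0<r<1} ∫₀^{2π} ‖x(r e^{is})‖² ds` of a function on the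
unit disk (only the values of `x` on the open unit disk matter). -/
def hardyNormSq {X : Type u} [NormedAddCommGroup X] (x : ℂ → X) : ℝ≥0∞ :=
  ENNReal.ofReal (2 * Real.pi)⁻¹ *
    ⨆ r ∈ Set.Ioo (0 : ℝ) 1, ∫⁻ s in Set.Ioc 0 (2 * Real.pi), ‖x (circleMap 0 r s)‖ₑ ^ 2

/-- `x` is holomorphic on the open unit disk and of finite Hardy norm, i.e. `x ∈ H²_X(𝔻)`. -/
def MemHardy {X : Type u} [NormedAddCommGroup X] [NormedSpace ℂ X] (x : ℂ → X) : Prop :=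
  DifferentiableOn ℂ x (Metric.ball 0 1) ∧ hardyNormSq x < ∞

/-- A contractive holomorphic operator function `θ` on the open unit disk is outer if
`θ H²_X(𝔻)` is dense in `H²_Y(𝔻)`. -/
def IsOuter {X : Type u} {Y : Type v} [NormedAddCommGroup X] [NormedSpace ℂ X]
    [NormedAddCommGroup Y] [NormedSpace ℂ Y] (θ : ℂ → X →L[ℂ] Y) : Prop :=
  DifferentiableOn ℂ θ (Metric.ball 0 1) ∧
  (∀ z ∈ Metric.ball (0 : ℂ) 1, ‖θ z‖ ≤ 1) ∧
  ∀ y : ℂ → Y, MemHardy y → ∀ ε : ℝ≥0∞, 0 < ε →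
    ∃ x : ℂ → X, MemHardy x ∧ hardyNormSq (fun z => y z - θ z (x z)) < ε

/-- `F(z) = F₀ + z F₁` is a linear outer function with
`F(ζ)* F(ζ) = I - T(ζ)* T(ζ)` for all `|ζ| = 1`. -/
def IsOuterFactor {H : Type u} [NormedAddCommGroup H] [InnerProductSpace ℂ H] [CompleteSpace H]
    {Y : Type v} [NormedAddCommGroup Y] [InnerProductSpace ℂ Y] [CompleteSpace Y]
    (T : LinearPencil H H) (F : LinearPencil H Y) : Prop :=
  IsOuter F.eval ∧
  ∀ ζ : ℂ, ‖ζ‖ = 1 →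
    adjoint (F.eval ζ) ∘L F.eval ζ =
      ContinuousLinearMap.id ℂ H - adjoint (T.eval ζ) ∘L T.eval ζ

/-! ### The canonical pencil -/

section Canonical

/-- The sequence `(0, y₀, y₁, …)`. -/
def shiftFun {Y : Type v} [Zero Y] (y : ℕ → Y) : ℕ → Y
  | 0 => 0
  | k + 1 => y k

theorem hasSum_shiftFun {Y : Type v} [NormedAddCommGroup Y] (y : lp (fun _ : ℕ => Y) 2) :
    HasSum (fun k => ‖shiftFun y k‖ ^ (2 : ℝ≥0∞).toReal) (‖y‖ ^ (2 : ℝ≥0∞).toReal) := by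
  have h := lp.hasSum_norm (p := 2) (by norm_num) y
  rw [← hasSum_nat_add_iff' 1]
  simpa [shiftFun] using h

variable (Y : Type v) [NormedAddCommGroup Y] [InnerProductSpace ℂ Y]
  (H : Type u) [NormedAddCommGroup H] [InnerProductSpace ℂ H]

/-- The space `K₊ = (⨁_{-∞}^{-1} Y) ⊕ H` (Hilbert space direct sums). The entry with index
`k : ℕ` of the sequence is the component with index `-(k+1)` of `⨁_{-∞}^{-1} Y`. -/
abbrev KPlus : Type (max v u) := WithLp 2 (lp (fun _ : ℕ => Y) 2 × H)

/-- The shift `(y₀, y₁, …) ↦ (0, y₀, y₁, …)` on `⨁_{-∞}^{-1} Y`. -/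
def shift : lp (fun _ : ℕ => Y) 2 →ₗᵢ[ℂ] lp (fun _ : ℕ => Y) 2 where
  toFun y := ⟨shiftFun y, memℓp_gen (hasSum_shiftFun y).summable⟩
  map_add' y y' := by
    ext k
    change shiftFun (y + y' : lp (fun _ : ℕ => Y) 2) k = shiftFun y k + shiftFun y' k
    cases k <;> simp [shiftFun]
  map_smul' c y := by
    ext k
    change shiftFun (c • y : lp (fun _ : ℕ => Y) 2) k = c • shiftFun y k
    cases k <;> simp [shiftFun]
  norm_map' y := by
    have h1 := lp.hasSum_norm (p := 2) (by norm_num)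
      (⟨shiftFun y, memℓp_gen (hasSum_shiftFun y).summable⟩ : lp (fun _ : ℕ => Y) 2)
    have h2 := h1.unique (hasSum_shiftFun y)
    exact (Real.rpow_left_inj (norm_nonneg _) (norm_nonneg _) (by norm_num)).1 h2

/-- The embedding of `Y` as the component with index `-1` of `⨁_{-∞}^{-1} Y`. -/
def lastComponent : Y →ₗᵢ[ℂ] lp (fun _ : ℕ => Y) 2 where
  toLinearMap := lp.lsingle (𝕜 := ℂ) (E := fun _ : ℕ => Y) 2 0
  norm_map' y := lp.norm_single (E := fun _ : ℕ => Y) (by norm_num) 0 y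

/-- The embedding `h ↦ col(…, 0, 0, h)` of `H` into `K₊`. -/
def embedKPlus : H →ₗᵢ[ℂ] KPlus Y H where
  toFun h := WithLp.toLp 2 (0, h)
  map_add' h h' := by
    rw [← WithLp.toLp_add]
    simp
  map_smul' c h := by
    rw [RingHom.id_apply, ← WithLp.toLp_smul]
    simp
  norm_map' h := WithLp.norm_toLp_snd 2 (lp (fun _ : ℕ => Y) 2) H h

variable {Y H}

/-- The operator on `K₊` given by the block column `col(B, A)` in the column of `H`, with
`B : H → Y` in the row with index `-1` and `A : H → H` in the row of `H`, and zeros elsewhere. -/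
def blockColumn (B : H →L[ℂ] Y) (A : H →L[ℂ] H) : KPlus Y H →L[ℂ] KPlus Y H :=
  (WithLp.prodContinuousLinearEquiv 2 ℂ (lp (fun _ : ℕ => Y) 2) H).symm.toContinuousLinearMap ∘L
    (((lastComponent Y).toContinuousLinearMap ∘L B).prod A) ∘L
    ContinuousLinearMap.snd ℂ (lp (fun _ : ℕ => Y) 2) H ∘L
    (WithLp.prodContinuousLinearEquiv 2 ℂ (lp (fun _ : ℕ => Y) 2) H).toContinuousLinearMap

/-- The operator on `K₊` with the identities `I_Y` from the component `-k` to the component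
`-(k+1)`, `k ≥ 1`, and zeros elsewhere. -/
def blockShift : KPlus Y H →L[ℂ] KPlus Y H :=
  (WithLp.prodContinuousLinearEquiv 2 ℂ (lp (fun _ : ℕ => Y) 2) H).symm.toContinuousLinearMap ∘L
    ((shift Y).toContinuousLinearMap.prod 0) ∘L
    ContinuousLinearMap.fst ℂ (lp (fun _ : ℕ => Y) 2) H ∘L
    (WithLp.prodContinuousLinearEquiv 2 ℂ (lp (fun _ : ℕ => Y) 2) H).toContinuousLinearMap

/-- The pencil `V(z)` on `K₊` whose matrix has the identities `I_Y` from the component `-k` to the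
component `-(k+1)`, `k ≥ 1`, the entry `F(z)` from `H` to the component `-1`, the entry `T(z)`
from `H` to `H`, and zeros elsewhere. -/
def canonicalPencil (T : LinearPencil H H) (F : LinearPencil H Y) :
    LinearPencil (KPlus Y H) (KPlus Y H) where
  coeff0 := blockShift + blockColumn F.coeff0 T.coeff0
  coeff1 := blockColumn F.coeff1 T.coeff1

theorem canonicalPencil_eval_snd (T : LinearPencil H H) (F : LinearPencil H Y) (z : ℂ)
    (x : KPlus Y H) : ((canonicalPencil T F).eval z x).snd = T.eval z x.snd := by
  simp [canonicalPencil, LinearPencil.eval, blockShift, blockColumn]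

theorem canonicalPencil_eval_fst (T : LinearPencil H H) (F : LinearPencil H Y) (z : ℂ)
    (x : KPlus Y H) : ((canonicalPencil T F).eval z x).fst =
      shift Y x.fst + lastComponent Y (F.eval z x.snd) := by
  simp [canonicalPencil, LinearPencil.eval, blockShift, blockColumn, add_assoc]

theorem canonicalPencil_eval_fst_zero (T : LinearPencil H H) (F : LinearPencil H Y) (z : ℂ)
    (x : KPlus Y H) : ((canonicalPencil T F).eval z x).fst 0 = F.eval z x.snd := by
  rw [canonicalPencil_eval_fst, lp.coeFn_add, Pi.add_apply]
  change (0 : Y) + Pi.single (M := fun _ : ℕ => Y) 0 (F.eval z x.snd) 0 = _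
  simp

theorem canonicalPencil_eval_fst_succ (T : LinearPencil H H) (F : LinearPencil H Y) (z : ℂ)
    (x : KPlus Y H) (k : ℕ) :
    ((canonicalPencil T F).eval z x).fst (k + 1) = x.fst k := by
  rw [canonicalPencil_eval_fst, lp.coeFn_add, Pi.add_apply]
  change x.fst k + Pi.single (M := fun _ : ℕ => Y) 0 (F.eval z x.snd) (k + 1) = _
  simp

end Canonical

end

/-!
Let `𝒯` be the analytic Toeplitz operator of `T` on `ℓ²(H)`, that is, multiplication by `T` on
`H²_H(𝔻)`; it is a contraction and commutes with the shift `S`. Let `R` have dense range and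
satisfy `R*R = 1 - 𝒯*𝒯`. As `‖R S x‖ = ‖R x‖`, there is an isometry `M` with `R S = M R`, and
because `T` has degree one, `M*² R` vanishes on the constants. In the Wold decomposition of `M` the
operator `R` is therefore the Toeplitz operator of a pencil `F`: the identity `R*R = 1 - 𝒯*𝒯` gives
`F(ζ)*F(ζ) = 1 - T(ζ)*T(ζ)` on the circle, and the dense range of `R` makes `F` outer.

A compression of an isometric pencil can only be isometric if the subspace is invariant. An
invariant subspace of `V` which contains `H` contains the component `-1` since `F(0)` has dense
range, and then every other component by shifting.
-/

noncomputable section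

open MeasureTheory Filter Topology

section CircleSeries

theorem integral_conj_circleMap_pow_mul_circleMap_pow (k j : ℕ) :
    ∫ s in (0 : ℝ)..2 * Real.pi,
        (starRingEnd ℂ) (circleMap 0 1 s ^ k) * circleMap 0 1 s ^ j =
      if k = j then (2 * Real.pi : ℂ) else 0 := by
  have hexp (s : ℝ) : (starRingEnd ℂ) (circleMap 0 1 s ^ k) * circleMap 0 1 s ^ j =
      Complex.exp (((j : ℂ) - k) * Complex.I * s) := by
    simp only [circleMap, zero_add, Complex.ofReal_one, one_mul, ← Complex.exp_conj,
      map_mul, map_natCast, Complex.conj_I, Complex.conj_ofReal, ← Complex.exp_nat_mul,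
      ← Complex.exp_add]
    ring_nf
  simp_rw [hexp]
  split_ifs with h
  · simp [h]
  · have hc : ((j : ℂ) - k) * Complex.I ≠ 0 :=
      mul_ne_zero (sub_ne_zero.2 fun h' => h (by exact_mod_cast h'.symm)) Complex.I_ne_zero
    have hperiod : Complex.exp (((j : ℂ) - k) * Complex.I * (2 * Real.pi : ℝ)) = 1 :=
      Complex.exp_eq_one_iff.2 ⟨(j : ℤ) - k, by push_cast; ring⟩
    rw [integral_exp_mul_complex hc, hperiod]
    simp

variable {E : Type*} [NormedAddCommGroup E] [InnerProductSpace ℂ E]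

theorem norm_circleMap_pow_smul (k : ℕ) (s : ℝ) (c : E) : ‖circleMap 0 1 s ^ k • c‖ = ‖c‖ := by
  simp [norm_smul]

variable {b : ℕ → E} {g : ℝ → E}

theorem integral_inner_circleMap_pow_smul (hb : Summable fun k => ‖b k‖)
    (hg : ∀ s, HasSum (fun k => circleMap 0 1 s ^ k • b k) (g s)) (k : ℕ) (c : E) :
    ∫ s in (0 : ℝ)..2 * Real.pi, inner ℂ (circleMap 0 1 s ^ k • c) (g s) =
      2 * Real.pi * inner ℂ c (b k) := by
  have hterm (j : ℕ) : ∫ s in (0 : ℝ)..2 * Real.pi,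
      inner ℂ (circleMap 0 1 s ^ k • c) (circleMap 0 1 s ^ j • b j) =
        if k = j then 2 * Real.pi * inner ℂ c (b k) else 0 := by
    simp_rw [inner_smul_left, inner_smul_right, ← mul_assoc,
      intervalIntegral.integral_mul_const, integral_conj_circleMap_pow_mul_circleMap_pow]
    split_ifs with h <;> simp [h]
  have hsum : HasSum (fun j => ∫ s in (0 : ℝ)..2 * Real.pi,
      inner ℂ (circleMap 0 1 s ^ k • c) (circleMap 0 1 s ^ j • b j))
      (∫ s in (0 : ℝ)..2 * Real.pi, inner ℂ (circleMap 0 1 s ^ k • c) (g s)) := by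
    refine intervalIntegral.hasSum_integral_of_dominated_convergence (fun j _ => ‖c‖ * ‖b j‖)
      (fun j => Continuous.aestronglyMeasurable (by fun_prop)) (fun j => ?_) ?_ ?_ ?_
    · refine Eventually.of_forall fun s _ => (norm_inner_le_norm _ _).trans_eq ?_
      rw [norm_circleMap_pow_smul, norm_circleMap_pow_smul]
    · exact Eventually.of_forall fun _ _ => hb.mul_left _
    · exact intervalIntegrable_const
    · exact Eventually.of_forall fun s _ => (hg s).mapL (innerSL ℂ (circleMap 0 1 s ^ k • c))
  simp_rw [hterm] at hsum
  refine hsum.unique ?_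
  simpa only [eq_comm] using hasSum_ite_eq k (2 * Real.pi * inner ℂ c (b k))

variable [CompleteSpace E]

theorem continuous_of_hasSum_circleMap_pow_smul (hb : Summable fun k => ‖b k‖)
    (hg : ∀ s, HasSum (fun k => circleMap 0 1 s ^ k • b k) (g s)) : Continuous g := by
  rw [funext fun s => (hg s).tsum_eq.symm]
  exact continuous_tsum (fun k => by fun_prop) hb fun k s => (norm_circleMap_pow_smul k s _).le

theorem hasSum_norm_sq_integral_circleMap (hb : Summable fun k => ‖b k‖)
    (hg : ∀ s, HasSum (fun k => circleMap 0 1 s ^ k • b k) (g s)) :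
    HasSum (fun k => 2 * Real.pi * ‖b k‖ ^ 2) (∫ s in (0 : ℝ)..2 * Real.pi, ‖g s‖ ^ 2) := by
  have hcont := continuous_of_hasSum_circleMap_pow_smul hb hg
  have hsum : HasSum (fun k => ∫ s in (0 : ℝ)..2 * Real.pi,
      inner ℂ (circleMap 0 1 s ^ k • b k) (g s))
      (∫ s in (0 : ℝ)..2 * Real.pi, inner ℂ (g s) (g s)) := by
    refine intervalIntegral.hasSum_integral_of_dominated_convergence (fun k s => ‖b k‖ * ‖g s‖)
      (fun k => Continuous.aestronglyMeasurable (by fun_prop)) (fun k => ?_) ?_ ?_ ?_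
    · refine Eventually.of_forall fun s _ => (norm_inner_le_norm _ _).trans_eq ?_
      rw [norm_circleMap_pow_smul]
    · exact Eventually.of_forall fun _ _ => hb.mul_right _
    · simp_rw [tsum_mul_right]
      exact (hcont.norm.const_mul _).intervalIntegrable _ _
    · exact Eventually.of_forall fun s _ => (hg s).mapL ((innerSL ℂ).flip (g s))
  simp_rw [integral_inner_circleMap_pow_smul hb hg, inner_self_eq_norm_sq_to_K] at hsum
  rw [← Complex.hasSum_ofReal, ← intervalIntegral.integral_ofReal]
  push_cast
  exact hsum

theorem lintegral_enorm_sq_of_hasSum_circleMap_pow_smul (hb : Summable fun k => ‖b k‖)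
    (hg : ∀ s, HasSum (fun k => circleMap 0 1 s ^ k • b k) (g s)) :
    ∫⁻ s in Set.Ioc 0 (2 * Real.pi), ‖g s‖ₑ ^ 2 =
      ENNReal.ofReal (2 * Real.pi) * ∑' k, ‖b k‖ₑ ^ 2 := by
  have hcont := continuous_of_hasSum_circleMap_pow_smul hb hg
  have hparseval := hasSum_norm_sq_integral_circleMap hb hg
  have enorm_sq (v : E) : ‖v‖ₑ ^ 2 = ENNReal.ofReal (‖v‖ ^ 2) := by
    rw [ENNReal.ofReal_pow (norm_nonneg _), ofReal_norm]
  have hint : IntegrableOn (fun s => ‖g s‖ ^ 2) (Set.Ioc 0 (2 * Real.pi)) :=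
    (hcont.norm.pow 2).integrableOn_Icc.mono_set Set.Ioc_subset_Icc_self
  simp_rw [enorm_sq]
  rw [← ofReal_integral_eq_lintegral_ofReal hint (Eventually.of_forall fun s => by positivity),
    ← intervalIntegral.integral_of_le (by positivity), ← hparseval.tsum_eq,
    ENNReal.ofReal_tsum_of_nonneg (fun k => by positivity) hparseval.summable,
    ← ENNReal.tsum_mul_left]
  exact tsum_congr fun k => ENNReal.ofReal_mul (by positivity)

end CircleSeries

section DiskSeries

variable {E : Type*} [NormedAddCommGroup E]

theorem hardyNormSq_mono {F : Type*} [NormedAddCommGroup F] {g : ℂ → E} {h : ℂ → F}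
    (hle : ∀ z ∈ Metric.ball (0 : ℂ) 1, ‖g z‖ ≤ ‖h z‖) : hardyNormSq g ≤ hardyNormSq h := by
  unfold hardyNormSq
  gcongr with r hr s
  exact enorm_le_iff_norm_le.2 (hle _ (by simpa [abs_of_pos hr.1] using hr.2))

theorem iSup_tsum_enorm_sq_pow_smul [NormedSpace ℂ E] (a : ℕ → E) :
    ⨆ r ∈ Set.Ioo (0 : ℝ) 1, ∑' k, ‖(r : ℂ) ^ k • a k‖ₑ ^ 2 = ∑' k, ‖a k‖ₑ ^ 2 := by
  refine le_antisymm (iSup₂_le fun r hr => ENNReal.tsum_le_tsum fun k => ?_) ?_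
  · gcongr
    rw [enorm_le_iff_norm_le, norm_smul, norm_pow, Complex.norm_real, Real.norm_of_nonneg hr.1.le]
    exact mul_le_of_le_one_left (norm_nonneg _) (pow_le_one₀ hr.1.le hr.2.le)
  · rw [ENNReal.tsum_eq_iSup_sum]
    refine iSup_le fun t => ?_
    have hlim : Tendsto (fun r : ℝ => ∑ k ∈ t, ‖(r : ℂ) ^ k • a k‖ₑ ^ 2) (𝓝[<] 1)
        (𝓝 (∑ k ∈ t, ‖a k‖ₑ ^ 2)) := by
      have hcont : Continuous fun r : ℝ => ∑ k ∈ t, ‖(r : ℂ) ^ k • a k‖ₑ ^ 2 :=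
        continuous_finsetSum t fun k _ => (ENNReal.continuous_pow 2).comp (by fun_prop)
      simpa using (hcont.tendsto 1).mono_left nhdsWithin_le_nhds
    refine le_of_tendsto hlim ?_
    filter_upwards [Ioo_mem_nhdsLT one_pos] with r hr
    exact (ENNReal.sum_le_tsum t).trans (le_iSup₂ (f := fun (r : ℝ) (_ : r ∈ Set.Ioo (0 : ℝ) 1) =>
      ∑' k, ‖(r : ℂ) ^ k • a k‖ₑ ^ 2) r hr)

theorem summable_norm_pow_smul_of_hasSum [NormedSpace ℂ E] {a : ℕ → E} {g : ℂ → E}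
    (h : ∀ z ∈ Metric.ball (0 : ℂ) 1, HasSum (fun k => z ^ k • a k) (g z))
    {r : ℝ} (hr : r ∈ Set.Ioo (0 : ℝ) 1) : Summable fun k => ‖(r : ℂ) ^ k • a k‖ := by
  obtain ⟨ρ, hrρ, hρ1⟩ := exists_between hr.2
  have hρ0 : 0 < ρ := hr.1.trans hrρ
  have hterms : Tendsto (fun k => (ρ : ℂ) ^ k • a k) atTop (𝓝 0) :=
    (h (ρ : ℂ) (by simpa [abs_of_pos hρ0] using hρ1)).summable.tendsto_atTop_zero
  obtain ⟨C, hC⟩ := hterms.norm.bddAbove_range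
  refine .of_nonneg_of_le (fun k => norm_nonneg _) (fun k => ?_)
    ((summable_geometric_of_lt_one (div_pos hr.1 hρ0).le ((div_lt_one hρ0).2 hrρ)).mul_left C)
  calc ‖(r : ℂ) ^ k • a k‖ = ‖(ρ : ℂ) ^ k • a k‖ * (r / ρ) ^ k := by
        simp only [norm_smul, norm_pow, Complex.norm_real, Real.norm_of_nonneg hr.1.le,
          Real.norm_of_nonneg hρ0.le, div_pow]
        field_simp
    _ ≤ C * (r / ρ) ^ k :=
        mul_le_mul_of_nonneg_right (hC ⟨k, rfl⟩) (pow_nonneg (div_pos hr.1 hρ0).le k)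

theorem exists_hasSum_of_differentiableOn [NormedSpace ℂ E] [CompleteSpace E] {g : ℂ → E}
    (hg : DifferentiableOn ℂ g (Metric.ball 0 1)) :
    ∃ a : ℕ → E, ∀ z ∈ Metric.ball (0 : ℂ) 1, HasSum (fun k => z ^ k • a k) (g z) := by
  refine ⟨fun k => ((k.factorial : ℂ)⁻¹) • iteratedDeriv k g 0, fun z hz => ?_⟩
  simpa only [sub_zero, smul_comm _ (z ^ _)] using Complex.hasSum_taylorSeries_on_ball hg hz

variable [InnerProductSpace ℂ E] [CompleteSpace E] {g : ℂ → E}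

theorem hardyNormSq_eq_tsum {a : ℕ → E}
    (h : ∀ z ∈ Metric.ball (0 : ℂ) 1, HasSum (fun k => z ^ k • a k) (g z)) :
    hardyNormSq g = ∑' k, ‖a k‖ₑ ^ 2 := by
  rw [← iSup_tsum_enorm_sq_pow_smul, hardyNormSq]
  simp_rw [ENNReal.mul_iSup]
  refine iSup_congr fun r => iSup_congr fun hr => ?_
  have hseries (s : ℝ) : HasSum (fun k => circleMap 0 1 s ^ k • (r : ℂ) ^ k • a k)
      (g (circleMap 0 r s)) := by
    have hcircle : circleMap 0 r s = circleMap 0 1 s * r := by simp [circleMap, mul_comm]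
    have hz := h (circleMap 0 r s) (by simpa [abs_of_pos hr.1] using hr.2)
    simpa only [hcircle, mul_pow, mul_smul] using hz
  rw [lintegral_enorm_sq_of_hasSum_circleMap_pow_smul (summable_norm_pow_smul_of_hasSum h hr)
    hseries, ← mul_assoc, ← ENNReal.ofReal_mul (by positivity),
    inv_mul_cancel₀ (by positivity), ENNReal.ofReal_one, one_mul]

theorem enorm_sq_apply_zero_le_hardyNormSq (hg : DifferentiableOn ℂ g (Metric.ball 0 1)) :
    ‖g 0‖ₑ ^ 2 ≤ hardyNormSq g := by
  obtain ⟨a, ha⟩ := exists_hasSum_of_differentiableOn hg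
  have hzero : g 0 = a 0 := by
    refine (ha 0 (by simp)).unique ?_
    simpa using hasSum_single (f := fun k => (0 : ℂ) ^ k • a k) 0 fun k hk => by simp [hk]
  rw [hardyNormSq_eq_tsum ha, hzero]
  exact ENNReal.le_tsum 0

theorem hardyNormSq_const (c : E) : hardyNormSq (fun _ => c) = ‖c‖ₑ ^ 2 := by
  have hc (z : ℂ) : HasSum (fun k => z ^ k • (Pi.single 0 c : ℕ → E) k) c := by
    simpa using hasSum_single (f := fun k => z ^ k • (Pi.single 0 c : ℕ → E) k) 0
      fun k hk => by simp [hk]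
  rw [hardyNormSq_eq_tsum (g := fun _ => c) fun z _ => hc z,
    tsum_eq_single 0 fun k hk => by simp [hk], Pi.single_eq_same]

theorem IsOuter.denseRange_apply_zero {X : Type*} [NormedAddCommGroup X] [NormedSpace ℂ X]
    {θ : ℂ → X →L[ℂ] E} (hθ : IsOuter θ) : DenseRange (θ 0) := by
  refine fun c => Metric.mem_closure_iff.2 fun ε hε => ?_
  have hconst : MemHardy fun _ : ℂ => c :=
    ⟨differentiableOn_const c, by rw [hardyNormSq_const]; simp⟩
  obtain ⟨x, hx, hlt⟩ := hθ.2.2 _ hconst (ENNReal.ofReal ε ^ 2) (by positivity)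
  have hdiff : DifferentiableOn ℂ (fun z => c - θ z (x z)) (Metric.ball 0 1) :=
    (differentiableOn_const c).sub (hθ.1.clm_apply hx.1)
  have hclose := (enorm_sq_apply_zero_le_hardyNormSq hdiff).trans_lt hlt
  rw [ENNReal.pow_lt_pow_left_iff two_ne_zero, ← ofReal_norm,
    ENNReal.ofReal_lt_ofReal_iff hε, ← dist_eq_norm] at hclose
  exact ⟨θ 0 (x 0), ⟨x 0, rfl⟩, hclose⟩

end DiskSeries

section Sequences

theorem hasSum_norm_sq_lp_two {E : Type*} [NormedAddCommGroup E] (x : lp (fun _ : ℕ => E) 2) :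
    HasSum (fun k => ‖x k‖ ^ 2) (‖x‖ ^ 2) := by
  simpa using lp.hasSum_norm (p := 2) (by norm_num) x

theorem memℓp_two_iff_summable {E : Type*} [NormedAddCommGroup E] {a : ℕ → E} :
    Memℓp a 2 ↔ Summable fun k => ‖a k‖ ^ 2 := by
  simpa using memℓp_gen_iff (p := 2) (f := a) (by norm_num)

theorem tsum_enorm_sq_lp_two {E : Type*} [NormedAddCommGroup E] (x : lp (fun _ : ℕ => E) 2) :
    ∑' k, ‖x k‖ₑ ^ 2 = ‖x‖ₑ ^ 2 := by
  have hx := hasSum_norm_sq_lp_two x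
  simp_rw [← ofReal_norm, ← ENNReal.ofReal_pow (norm_nonneg _)]
  rw [← hx.tsum_eq, ENNReal.ofReal_tsum_of_nonneg (fun k => by positivity) hx.summable]

theorem MemHardy.exists_hasSum_lp_two {E : Type*} [NormedAddCommGroup E] [InnerProductSpace ℂ E]
    [CompleteSpace E] {g : ℂ → E} (hg : MemHardy g) :
    ∃ x : lp (fun _ : ℕ => E) 2, ∀ z ∈ Metric.ball (0 : ℂ) 1,
      HasSum (fun k => z ^ k • x k) (g z) := by
  obtain ⟨a, ha⟩ := exists_hasSum_of_differentiableOn hg.1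
  have hfin : ∑' k, ‖a k‖ₑ ^ 2 ≠ ∞ := hardyNormSq_eq_tsum ha ▸ hg.2.ne
  exact ⟨⟨a, memℓp_two_iff_summable.2 (by simpa using ENNReal.summable_toReal hfin)⟩, ha⟩

/-- The holomorphic function on the unit disk whose Taylor coefficients are the entries of `x`:
the identification of `ℓ²(E)` with the Hardy space `H²_E(𝔻)`. -/
def hardyFunction {E : Type*} [NormedAddCommGroup E] [NormedSpace ℂ E]
    (x : lp (fun _ : ℕ => E) 2) (z : ℂ) : E :=
  ∑' k, z ^ k • x k

theorem summable_pow_mul_norm_lp_two {E : Type*} [NormedAddCommGroup E]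
    (x : lp (fun _ : ℕ => E) 2) {r : ℝ} (h0 : 0 ≤ r) (h1 : r < 1) :
    Summable fun k => r ^ k * ‖x k‖ :=
  .of_nonneg_of_le (fun k => by positivity)
    (fun k => mul_le_mul_of_nonneg_left (lp.norm_apply_le_norm two_ne_zero x k) (by positivity))
    ((summable_geometric_of_lt_one h0 h1).mul_right ‖x‖)

section HardyFunction

section NormedSpace

variable {E : Type*} [NormedAddCommGroup E] [NormedSpace ℂ E] [CompleteSpace E]
  (x : lp (fun _ : ℕ => E) 2)

theorem hasSum_hardyFunction {z : ℂ} (hz : z ∈ Metric.ball (0 : ℂ) 1) :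
    HasSum (fun k => z ^ k • x k) (hardyFunction x z) := by
  refine Summable.hasSum (.of_norm ?_)
  simpa [norm_smul] using summable_pow_mul_norm_lp_two x (norm_nonneg z) (by simpa using hz)

theorem differentiableOn_hardyFunction :
    DifferentiableOn ℂ (hardyFunction x) (Metric.ball 0 1) := by
  intro z hz
  obtain ⟨r, hzr, hr⟩ := exists_between (mem_ball_zero_iff.1 hz)
  have hdiff : DifferentiableOn ℂ (hardyFunction x) (Metric.ball 0 r) := by
    refine Complex.differentiableOn_tsum_of_summable_norm
      (summable_pow_mul_norm_lp_two x ((norm_nonneg z).trans hzr.le) hr) (fun k => by fun_prop)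
      Metric.isOpen_ball fun k w hw => ?_
    rw [norm_smul, norm_pow]
    have := (mem_ball_zero_iff.1 hw).le
    gcongr
  exact (hdiff.differentiableAt
    (Metric.isOpen_ball.mem_nhds (mem_ball_zero_iff.2 hzr))).differentiableWithinAt

end NormedSpace

variable {E : Type*} [NormedAddCommGroup E] [InnerProductSpace ℂ E] [CompleteSpace E]
  (x : lp (fun _ : ℕ => E) 2)

theorem hardyNormSq_of_hasSum_lp_two {g : ℂ → E}
    (h : ∀ z ∈ Metric.ball (0 : ℂ) 1, HasSum (fun k => z ^ k • x k) (g z)) :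
    hardyNormSq g = ‖x‖ₑ ^ 2 := by
  rw [hardyNormSq_eq_tsum h, tsum_enorm_sq_lp_two]

theorem hardyNormSq_hardyFunction : hardyNormSq (hardyFunction x) = ‖x‖ₑ ^ 2 :=
  hardyNormSq_of_hasSum_lp_two x fun _ => hasSum_hardyFunction x

theorem memHardy_hardyFunction : MemHardy (hardyFunction x) :=
  ⟨differentiableOn_hardyFunction x, by rw [hardyNormSq_hardyFunction]; simp⟩

end HardyFunction

section Shift

variable {Y : Type*} [NormedAddCommGroup Y] [InnerProductSpace ℂ Y]

theorem shift_apply_zero (y : lp (fun _ : ℕ => Y) 2) : shift Y y 0 = 0 := rfl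

theorem shift_apply_succ (y : lp (fun _ : ℕ => Y) 2) (k : ℕ) : shift Y y (k + 1) = y k := rfl

theorem lastComponent_apply_zero (c : Y) : lastComponent Y c 0 = c :=
  lp.single_apply_self (E := fun _ : ℕ => Y) 2 0 c

theorem lastComponent_apply_succ (c : Y) (k : ℕ) : lastComponent Y c (k + 1) = 0 :=
  lp.single_apply_ne (E := fun _ : ℕ => Y) 2 0 c (Nat.succ_ne_zero k)

theorem shift_single (k : ℕ) (c : Y) :
    shift Y (lp.single (E := fun _ : ℕ => Y) 2 k c) = lp.single 2 (k + 1) c := by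
  ext j
  cases j with
  | zero => exact (lp.single_apply_ne (E := fun _ : ℕ => Y) 2 (k + 1) c k.succ_ne_zero.symm).symm
  | succ j => simp [shift_apply_succ, lp.single_apply, Pi.single_apply]

theorem inner_shift_lastComponent (y : lp (fun _ : ℕ => Y) 2) (c : Y) :
    inner ℂ (shift Y y) (lastComponent Y c) = 0 :=
  (lp.inner_single_right (G := fun _ : ℕ => Y) 0 c (shift Y y)).trans
    (by rw [shift_apply_zero, inner_zero_left])

theorem norm_sq_shift_add_lastComponent (y : lp (fun _ : ℕ => Y) 2) (c : Y) :
    ‖shift Y y + lastComponent Y c‖ ^ 2 = ‖y‖ ^ 2 + ‖c‖ ^ 2 := by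
  rw [norm_add_sq (𝕜 := ℂ), inner_shift_lastComponent, LinearIsometry.norm_map,
    LinearIsometry.norm_map, map_zero, mul_zero, add_zero]

theorem eq_top_of_shift_mem_of_lastComponent_mem {L : Submodule ℂ (lp (fun _ : ℕ => Y) 2)}
    (hclosed : IsClosed (L : Set (lp (fun _ : ℕ => Y) 2)))
    (hshift : ∀ y ∈ L, shift Y y ∈ L) (hlast : ∀ c, lastComponent Y c ∈ L) : L = ⊤ := by
  have hsingle (k : ℕ) (c : Y) : lp.single (E := fun _ : ℕ => Y) 2 k c ∈ L := by
    induction k with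
    | zero => exact hlast c
    | succ k ih => exact shift_single k c ▸ hshift _ ih
  refine (Submodule.eq_top_iff').2 fun y => ?_
  exact hclosed.mem_of_tendsto (lp.hasSum_single (E := fun _ : ℕ => Y) (by simp) y)
    (Eventually.of_forall fun s => L.sum_mem fun k _ => hsingle k _)

end Shift

end Sequences

section Toeplitz

theorem memℓp_two_clm_apply {E F : Type*} [NormedAddCommGroup E] [NormedSpace ℂ E]
    [NormedAddCommGroup F] [NormedSpace ℂ F] (A : E →L[ℂ] F) {x : ℕ → E} (hx : Memℓp x 2) :
    Memℓp (fun k => A (x k)) 2 := by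
  rw [memℓp_two_iff_summable] at hx ⊢
  refine .of_nonneg_of_le (fun k => by positivity) (fun k => ?_) (hx.mul_left (‖A‖ ^ 2))
  rw [← mul_pow]
  gcongr
  exact A.le_opNorm _

/-- The operator `(x₀, x₁, …) ↦ (A x₀, A x₁, …)` on square summable sequences. -/
def entrywise {E F : Type*} [NormedAddCommGroup E] [NormedSpace ℂ E]
    [NormedAddCommGroup F] [NormedSpace ℂ F] (A : E →L[ℂ] F) :
    lp (fun _ : ℕ => E) 2 →L[ℂ] lp (fun _ : ℕ => F) 2 :=
  LinearMap.mkContinuous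
    { toFun := fun x => (⟨fun k => A (x k), memℓp_two_clm_apply A x.2⟩ : lp (fun _ : ℕ => F) 2)
      map_add' := fun x y => by ext k; exact map_add A (x k) (y k)
      map_smul' := fun c x => by ext k; exact map_smul A c (x k) } ‖A‖ fun x => by
    refine (sq_le_sq₀ (norm_nonneg _) (by positivity)).1 ?_
    refine hasSum_le (fun k => ?_) (hasSum_norm_sq_lp_two _)
      (mul_pow ‖A‖ ‖x‖ 2 ▸ (hasSum_norm_sq_lp_two x).mul_left (‖A‖ ^ 2))
    rw [← mul_pow]
    gcongr
    exact A.le_opNorm _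

namespace LinearPencil

variable {E F : Type*} [NormedAddCommGroup E] [InnerProductSpace ℂ E]
  [NormedAddCommGroup F] [InnerProductSpace ℂ F] (A : LinearPencil E F)

theorem eval_apply (z : ℂ) (x : E) : A.eval z x = A.coeff0 x + z • A.coeff1 x := rfl

theorem eval_zero : A.eval 0 = A.coeff0 := by
  simp [eval]

theorem coeff0_apply (x : E) : A.coeff0 x = (2⁻¹ : ℂ) • (A.eval 1 x + A.eval (-1) x) := by
  simp only [eval_apply]
  module

theorem differentiable_eval : Differentiable ℂ A.eval := by
  unfold eval
  fun_prop

theorem norm_eval_le_one_of_mem_ball (hA : ∀ ζ : ℂ, ‖ζ‖ = 1 → ‖A.eval ζ‖ ≤ 1) {z : ℂ}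
    (hz : z ∈ Metric.ball (0 : ℂ) 1) : ‖A.eval z‖ ≤ 1 := by
  refine Complex.norm_le_of_forall_mem_frontier_norm_le Metric.isBounded_ball
    A.differentiable_eval.diffContOnCl (fun ζ hζ => hA ζ ?_) (subset_closure hz)
  simpa [frontier_ball (0 : ℂ) one_ne_zero] using hζ

/-- The analytic Toeplitz operator of a linear pencil: multiplication by the pencil on the Hardy
space, in terms of Taylor coefficients. -/
def toeplitz : lp (fun _ : ℕ => E) 2 →L[ℂ] lp (fun _ : ℕ => F) 2 :=
  entrywise A.coeff0 + (shift F).toContinuousLinearMap ∘L entrywise A.coeff1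

theorem toeplitz_apply_zero (x : lp (fun _ : ℕ => E) 2) :
    A.toeplitz x 0 = A.coeff0 (x 0) :=
  add_zero (A.coeff0 (x 0))

theorem toeplitz_apply_succ (x : lp (fun _ : ℕ => E) 2) (k : ℕ) :
    A.toeplitz x (k + 1) = A.coeff0 (x (k + 1)) + A.coeff1 (x k) := rfl

theorem toeplitz_shift (x : lp (fun _ : ℕ => E) 2) :
    A.toeplitz (shift E x) = shift F (A.toeplitz x) := by
  ext k
  rcases k with _ | _ | k <;>
    simp [toeplitz_apply_zero, toeplitz_apply_succ, shift_apply_zero, shift_apply_succ]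

theorem toeplitz_lastComponent (h : E) :
    A.toeplitz (lastComponent E h) =
      shift F (lastComponent F (A.coeff1 h)) + lastComponent F (A.coeff0 h) := by
  ext k
  rcases k with _ | _ | k <;>
    simp [toeplitz_apply_zero, toeplitz_apply_succ, shift_apply_zero, shift_apply_succ,
      lastComponent_apply_zero, lastComponent_apply_succ]

/-- For `x = (ζ h, h, 0, …)` the product `A x` is `(ζ A₀ h, A(ζ) h, A₁ h, 0, …)`, so the norms of
the Toeplitz operator determine those of the values on the circle. -/
theorem norm_sq_toeplitz_shift_add_lastComponent {ζ : ℂ} (hζ : ‖ζ‖ = 1) (h : E) :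
    ‖A.toeplitz (shift E (lastComponent E h) + lastComponent E (ζ • h))‖ ^ 2 =
      ‖A.toeplitz (lastComponent E h)‖ ^ 2 + ‖A.eval ζ h‖ ^ 2 := by
  have hcoeff : A.toeplitz (shift E (lastComponent E h) + lastComponent E (ζ • h)) =
      shift F (shift F (lastComponent F (A.coeff1 h)) + lastComponent F (A.eval ζ h)) +
        lastComponent F (ζ • A.coeff0 h) := by
    rw [map_add, toeplitz_shift, toeplitz_lastComponent, toeplitz_lastComponent, eval_apply]
    simp only [map_add, map_smul]
    abel
  rw [hcoeff, toeplitz_lastComponent, norm_sq_shift_add_lastComponent,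
    norm_sq_shift_add_lastComponent, norm_sq_shift_add_lastComponent, norm_smul, hζ, one_mul]
  ring

theorem hasSum_toeplitz {x : lp (fun _ : ℕ => E) 2} {z : ℂ} {g : E}
    (hg : HasSum (fun k => z ^ k • x k) g) :
    HasSum (fun k => z ^ k • A.toeplitz x k) (A.eval z g) := by
  have h0 := (hasSum_nat_add_iff' 1).2 (hg.mapL A.coeff0)
  have h1 := (hg.mapL A.coeff1).const_smul z
  rw [← hasSum_nat_add_iff' 1]
  convert h0.add h1 using 1
  · ext k
    simp [toeplitz_apply_succ, pow_succ', mul_smul, smul_add]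
  · simp [toeplitz_apply_zero, eval_apply, add_sub_right_comm]

section Hardy

variable {A} [CompleteSpace E] [CompleteSpace F]

theorem norm_toeplitz_apply_le (hA : ∀ ζ : ℂ, ‖ζ‖ = 1 → ‖A.eval ζ‖ ≤ 1)
    (x : lp (fun _ : ℕ => E) 2) : ‖A.toeplitz x‖ ≤ ‖x‖ := by
  have hle : hardyNormSq (fun z => A.eval z (hardyFunction x z)) ≤
      hardyNormSq (hardyFunction x) := hardyNormSq_mono fun z hz =>
    ((A.eval z).le_of_opNorm_le (A.norm_eval_le_one_of_mem_ball hA hz) _).trans_eq (one_mul _)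
  rw [hardyNormSq_of_hasSum_lp_two (A.toeplitz x) fun z hz =>
      A.hasSum_toeplitz (hasSum_hardyFunction x hz), hardyNormSq_hardyFunction,
    ENNReal.pow_le_pow_left_iff two_ne_zero] at hle
  exact enorm_le_iff_norm_le.1 hle

theorem isOuter_of_denseRange_toeplitz (hA : ∀ ζ : ℂ, ‖ζ‖ = 1 → ‖A.eval ζ‖ ≤ 1)
    (hdense : DenseRange A.toeplitz) : IsOuter A.eval := by
  refine ⟨A.differentiable_eval.differentiableOn,
    fun z hz => A.norm_eval_le_one_of_mem_ball hA hz, fun g hg ε hε => ?_⟩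
  obtain ⟨y, hy⟩ := hg.exists_hasSum_lp_two
  have hopen : IsOpen {c : lp (fun _ : ℕ => F) 2 | ‖y - c‖ₑ ^ 2 < ε} :=
    isOpen_Iio.preimage ((ENNReal.continuous_pow 2).comp (by fun_prop))
  obtain ⟨x, hx⟩ := hdense.exists_mem_open hopen ⟨y, by simpa using hε⟩
  refine ⟨hardyFunction x, memHardy_hardyFunction x, ?_⟩
  rw [hardyNormSq_of_hasSum_lp_two (y - A.toeplitz x) fun z hz => ?_]
  · exact hx
  · simpa [smul_sub] using (hy z hz).sub (A.hasSum_toeplitz (hasSum_hardyFunction x hz))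

end Hardy

end LinearPencil

end Toeplitz

section Operators

variable {E F G : Type*} [NormedAddCommGroup E] [InnerProductSpace ℂ E] [CompleteSpace E]
  [NormedAddCommGroup F] [InnerProductSpace ℂ F] [CompleteSpace F]
  [NormedAddCommGroup G] [InnerProductSpace ℂ G] [CompleteSpace G]

theorem adjoint_comp_self_eq_id_sub_iff {A : E →L[ℂ] F} {B : E →L[ℂ] G} :
    adjoint A ∘L A = ContinuousLinearMap.id ℂ E - adjoint B ∘L B ↔
      ∀ x, ‖A x‖ ^ 2 + ‖B x‖ ^ 2 = ‖x‖ ^ 2 := by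
  rw [← coe_inj, ← ext_inner_map]
  refine forall_congr' fun x => ?_
  simp only [coe_coe, comp_apply, sub_apply, id_apply, inner_sub_left, adjoint_inner_left,
    inner_self_eq_norm_sq_to_K, eq_sub_iff_add_eq]
  norm_cast

theorem inner_apply_apply_of_adjoint_comp_self {A : E →L[ℂ] F} {B : E →L[ℂ] G}
    (h : adjoint A ∘L A = ContinuousLinearMap.id ℂ E - adjoint B ∘L B) (x y : E) :
    inner ℂ (A x) (A y) = inner ℂ x y - inner ℂ (B x) (B y) := by
  rw [← adjoint_inner_right, ← comp_apply, h]
  simp [inner_sub_right, adjoint_inner_right]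

theorem isPositive_id_sub_adjoint_comp_self {B : E →L[ℂ] G} (hB : ∀ x, ‖B x‖ ≤ ‖x‖) :
    (ContinuousLinearMap.id ℂ E - adjoint B ∘L B).IsPositive := by
  refine (isPositive_iff_complex _).2 fun x => ?_
  have hinner : inner ℂ ((ContinuousLinearMap.id ℂ E - adjoint B ∘L B) x) x =
      ((‖x‖ ^ 2 - ‖B x‖ ^ 2 : ℝ) : ℂ) := by
    simp [adjoint_inner_left, inner_self_eq_norm_sq_to_K]
  rw [hinner]
  exact ⟨rfl, sub_nonneg.2 (pow_le_pow_left₀ (norm_nonneg _) (hB x) 2)⟩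

theorem exists_denseRange_adjoint_comp_self_eq {E : Type u} [NormedAddCommGroup E]
    [InnerProductSpace ℂ E] [CompleteSpace E] {Q : E →L[ℂ] E} (hQ : Q.IsPositive) :
    ∃ (D : Type u) (_ : NormedAddCommGroup D) (_ : InnerProductSpace ℂ D) (_ : CompleteSpace D)
      (R : E →L[ℂ] D), DenseRange R ∧ adjoint R ∘L R = Q := by
  let S : E →L[ℂ] E := CFC.sqrt Q
  have hSS (x : E) : adjoint S (S x) = Q x := by
    rw [(IsSelfAdjoint.of_nonneg (CFC.sqrt_nonneg Q)).adjoint_eq]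
    exact DFunLike.congr_fun (CFC.sqrt_mul_sqrt_self Q ((nonneg_iff_isPositive Q).2 hQ)) x
  let D := S.range.topologicalClosure
  let R : E →L[ℂ] D := S.codRestrict D fun x => S.range.le_topologicalClosure ⟨x, rfl⟩
  refine ⟨D, inferInstance, inferInstance, inferInstance, R, fun y => ?_, ?_⟩
  · have himage : ((↑) '' Set.range R : Set E) = Set.range S := by
      rw [← Set.range_comp]
      rfl
    rw [closure_subtype, himage]
    exact y.2
  · ext x
    refine ext_inner_left ℂ fun y => ?_
    rw [comp_apply, adjoint_inner_right, Submodule.coe_inner, ← hSS, adjoint_inner_right]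
    rfl

theorem exists_linearIsometry_apply_eq {K E F : Type*} [NormedAddCommGroup K] [NormedSpace ℂ K]
    [NormedAddCommGroup E] [NormedSpace ℂ E] [NormedAddCommGroup F] [NormedSpace ℂ F]
    [CompleteSpace F] {R : K →L[ℂ] E} (hR : DenseRange R) {S : K →L[ℂ] F}
    (hS : ∀ x, ‖S x‖ = ‖R x‖) : ∃ M : E →ₗᵢ[ℂ] F, ∀ x, M (R x) = S x := by
  let M : E →L[ℂ] F := S.toLinearMap.extendOfNorm R.toLinearMap
  have hM (x : K) : M (R x) = S x :=
    LinearMap.extendOfNorm_eq (f := S.toLinearMap) (e := R.toLinearMap) hR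
      ⟨1, fun x => by simpa using (hS x).le⟩ x
  have hnorm (e : E) : ‖M e‖ = ‖e‖ :=
    hR.induction_on (p := fun e => ‖M e‖ = ‖e‖) e
      (isClosed_eq (by fun_prop) (by fun_prop)) fun x => by rw [hM, hS]
  exact ⟨⟨M.toLinearMap, hnorm⟩, hM⟩

end Operators

section Wold

variable {E : Type*} [NormedAddCommGroup E] [InnerProductSpace ℂ E]

/-- The wandering subspace `E ⊖ M E` of an isometry `M`. -/
def wanderingSubspace (M : E →ₗᵢ[ℂ] E) : Submodule ℂ E := (LinearMap.range M.toLinearMap)ᗮ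

theorem inner_apply_of_mem_wanderingSubspace {M : E →ₗᵢ[ℂ] E} {c : E}
    (hc : c ∈ wanderingSubspace M) (e : E) : inner ℂ c (M e) = 0 :=
  (Submodule.mem_orthogonal' _ _).1 hc _ ⟨e, rfl⟩

theorem orthogonalFamily_pow_wanderingSubspace (M : E →ₗᵢ[ℂ] E) :
    OrthogonalFamily ℂ (fun _ : ℕ => wanderingSubspace M)
      fun k => (M ^ k).comp (wanderingSubspace M).subtypeₗᵢ := by
  have hlt {i j : ℕ} (hij : i < j) (c d : wanderingSubspace M) :
      inner ℂ ((M ^ i) (c : E)) ((M ^ j) (d : E)) = 0 := by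
    obtain ⟨k, rfl⟩ := Nat.exists_eq_add_of_lt hij
    rw [add_assoc, pow_add, LinearIsometry.coe_mul, Function.comp_apply,
      LinearIsometry.inner_map_map, pow_succ', LinearIsometry.coe_mul, Function.comp_apply]
    exact inner_apply_of_mem_wanderingSubspace c.2 _
  intro i j hij c d
  rcases hij.lt_or_gt with h | h
  · exact hlt h c d
  · exact inner_eq_zero_symm.1 (hlt h d c)

variable [CompleteSpace E] (M : E →ₗᵢ[ℂ] E)

instance : CompleteSpace (wanderingSubspace M) :=
  inferInstanceAs (CompleteSpace (LinearMap.range M.toLinearMap)ᗮ)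

/-- The isometry `(c₀, c₁, …) ↦ ∑ Mᵏ cₖ` of the Wold decomposition of `M`; it identifies the
unilateral shift on the wandering subspace with the pure part of `M`. -/
def woldIsometry : lp (fun _ : ℕ => wanderingSubspace M) 2 →ₗᵢ[ℂ] E :=
  (orthogonalFamily_pow_wanderingSubspace M).linearIsometry

theorem hasSum_woldIsometry (y : lp (fun _ : ℕ => wanderingSubspace M) 2) :
    HasSum (fun k => (M ^ k) (y k : E)) (woldIsometry M y) :=
  (orthogonalFamily_pow_wanderingSubspace M).hasSum_linearIsometry y

theorem woldIsometry_shift (y : lp (fun _ : ℕ => wanderingSubspace M) 2) :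
    woldIsometry M (shift _ y) = M (woldIsometry M y) := by
  have hshift := (hasSum_nat_add_iff' 1).2 (hasSum_woldIsometry M (shift _ y))
  simp only [shift_apply_succ, shift_apply_zero, Finset.sum_range_one, pow_succ',
    LinearIsometry.coe_mul, Function.comp_apply, Submodule.coe_zero, map_zero, sub_zero] at hshift
  exact hshift.unique ((hasSum_woldIsometry M y).map M M.continuous)

theorem woldIsometry_lastComponent (c : wanderingSubspace M) :
    woldIsometry M (lastComponent _ c) = c :=
  (orthogonalFamily_pow_wanderingSubspace M).linearIsometry_apply_single (i := 0) c

theorem starProjection_wanderingSubspace_apply (e : E) :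
    (wanderingSubspace M).starProjection e = e - M (adjoint M.toContinuousLinearMap e) := by
  refine Submodule.eq_starProjection_of_mem_orthogonal ?_ ?_
  · refine (Submodule.mem_orthogonal _ _).2 ?_
    rintro _ ⟨e', rfl⟩
    have hadj := adjoint_inner_right M.toContinuousLinearMap e' e
    simp only [LinearIsometry.coe_toContinuousLinearMap, LinearIsometry.coe_toLinearMap,
      inner_sub_right, LinearIsometry.inner_map_map] at hadj ⊢
    rw [hadj, sub_self]
  · rw [sub_sub_cancel]
    exact Submodule.le_orthogonal_orthogonal (LinearMap.range M.toLinearMap) ⟨_, rfl⟩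

/-- The pencil `P D + z P M* D`, where `P` is the projection onto the wandering subspace of `M`: its
coefficients are the first two terms of the Wold expansion `D = ∑ Mᵏ P M*ᵏ D`. It is the outer
factor when `D` is the restriction to the constants of the dense-range `R` with
`R*R = 1 - 𝒯*𝒯`. -/
def wanderingPencil {H : Type*} [NormedAddCommGroup H] [InnerProductSpace ℂ H] (D : H →L[ℂ] E) :
    LinearPencil H (wanderingSubspace M) where
  coeff0 := (wanderingSubspace M).orthogonalProjectionOnto ∘L D
  coeff1 := (wanderingSubspace M).orthogonalProjectionOnto ∘L
    adjoint M.toContinuousLinearMap ∘L D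

variable {M} {H : Type*} [NormedAddCommGroup H] [InnerProductSpace ℂ H]

theorem woldIsometry_toeplitz_wanderingPencil_lastComponent {D : H →L[ℂ] E} {h : H}
    (hD : adjoint M.toContinuousLinearMap (adjoint M.toContinuousLinearMap (D h)) = 0) :
    woldIsometry M ((wanderingPencil M D).toeplitz (lastComponent H h)) = D h := by
  rw [LinearPencil.toeplitz_lastComponent, map_add, woldIsometry_shift,
    woldIsometry_lastComponent, woldIsometry_lastComponent]
  simp [wanderingPencil, starProjection_wanderingSubspace_apply, hD]

theorem woldIsometry_toeplitz_wanderingPencil {R : lp (fun _ : ℕ => H) 2 →L[ℂ] E}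
    (hshift : ∀ x, M (R x) = R (shift H x))
    (hlast : ∀ h, adjoint M.toContinuousLinearMap
      (adjoint M.toContinuousLinearMap (R (lastComponent H h))) = 0)
    (x : lp (fun _ : ℕ => H) 2) :
    woldIsometry M ((wanderingPencil M
      (R ∘L (lastComponent H).toContinuousLinearMap)).toeplitz x) = R x := by
  let W := (woldIsometry M).toContinuousLinearMap ∘L
    (wanderingPencil M (R ∘L (lastComponent H).toContinuousLinearMap)).toeplitz
  suffices htop : W.toLinearMap.eqLocus R.toLinearMap = ⊤ from
    LinearMap.mem_eqLocus.1 (htop ▸ Submodule.mem_top)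
  refine eq_top_of_shift_mem_of_lastComponent_mem (isClosed_eq W.continuous R.continuous)
    (fun y hy => ?_) fun h => woldIsometry_toeplitz_wanderingPencil_lastComponent (hlast h)
  have hWR : W y = R y := hy
  change W (shift H y) = R (shift H y)
  rw [← hshift, ← hWR]
  simp only [W, comp_apply, LinearIsometry.coe_toContinuousLinearMap, LinearPencil.toeplitz_shift,
    woldIsometry_shift]

end Wold

section Factorization

theorem norm_sq_eval_add_norm_sq_eval {H Y Z : Type*} [NormedAddCommGroup H]
    [InnerProductSpace ℂ H] [NormedAddCommGroup Y] [InnerProductSpace ℂ Y]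
    [NormedAddCommGroup Z] [InnerProductSpace ℂ Z] {F : LinearPencil H Y} {T : LinearPencil H Z}
    (hFT : ∀ x, ‖F.toeplitz x‖ ^ 2 + ‖T.toeplitz x‖ ^ 2 = ‖x‖ ^ 2) {ζ : ℂ} (hζ : ‖ζ‖ = 1) (h : H) :
    ‖F.eval ζ h‖ ^ 2 + ‖T.eval ζ h‖ ^ 2 = ‖h‖ ^ 2 := by
  have hlast := hFT (lastComponent H h)
  have hsum := hFT (shift H (lastComponent H h) + lastComponent H (ζ • h))
  rw [F.norm_sq_toeplitz_shift_add_lastComponent hζ,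
    T.norm_sq_toeplitz_shift_add_lastComponent hζ, norm_sq_shift_add_lastComponent, norm_smul, hζ,
    one_mul] at hsum
  rw [LinearIsometry.norm_map] at hlast hsum
  linarith

theorem exists_intertwining_linearIsometry {H Z E : Type*} [NormedAddCommGroup H]
    [InnerProductSpace ℂ H] [NormedAddCommGroup Z] [InnerProductSpace ℂ Z]
    [NormedAddCommGroup E] [InnerProductSpace ℂ E] [CompleteSpace E] {T : LinearPencil H Z}
    {R : lp (fun _ : ℕ => H) 2 →L[ℂ] E} (hR : DenseRange R)
    (hRT : ∀ x, ‖R x‖ ^ 2 + ‖T.toeplitz x‖ ^ 2 = ‖x‖ ^ 2) :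
    ∃ M : E →ₗᵢ[ℂ] E, ∀ x, M (R x) = R (shift H x) := by
  refine exists_linearIsometry_apply_eq hR (S := R ∘L (shift H).toContinuousLinearMap) fun x => ?_
  have hx := hRT x
  have hSx := hRT (shift H x)
  rw [LinearPencil.toeplitz_shift, LinearIsometry.norm_map, LinearIsometry.norm_map, ← hx,
    add_left_inj] at hSx
  exact (sq_eq_sq₀ (norm_nonneg _) (norm_nonneg _)).1 hSx

variable {H Z E : Type*} [NormedAddCommGroup H] [InnerProductSpace ℂ H] [CompleteSpace H]
  [NormedAddCommGroup Z] [InnerProductSpace ℂ Z] [CompleteSpace Z]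
  [NormedAddCommGroup E] [InnerProductSpace ℂ E] [CompleteSpace E]

theorem adjoint_adjoint_apply_lastComponent_eq_zero {T : LinearPencil H Z}
    {R : lp (fun _ : ℕ => H) 2 →L[ℂ] E} (hR : DenseRange R)
    (hRT : adjoint R ∘L R = ContinuousLinearMap.id ℂ _ - adjoint T.toeplitz ∘L T.toeplitz)
    {M : E →ₗᵢ[ℂ] E} (hM : ∀ x, M (R x) = R (shift H x)) (h : H) :
    adjoint M.toContinuousLinearMap
      (adjoint M.toContinuousLinearMap (R (lastComponent H h))) = 0 := by
  refine hR.eq_zero_of_inner_left ℂ ?_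
  intro x
  rw [adjoint_inner_left, adjoint_inner_left, LinearIsometry.coe_toContinuousLinearMap, hM, hM,
    inner_apply_apply_of_adjoint_comp_self hRT, LinearPencil.toeplitz_shift,
    LinearPencil.toeplitz_shift, LinearPencil.toeplitz_lastComponent, inner_add_left,
    LinearIsometry.inner_map_map, inner_eq_zero_symm.1 (inner_shift_lastComponent _ _),
    inner_eq_zero_symm.1 (inner_shift_lastComponent _ _),
    inner_eq_zero_symm.1 (inner_shift_lastComponent _ _), add_zero, sub_zero]

theorem exists_toeplitz_factor {H : Type u} [NormedAddCommGroup H] [InnerProductSpace ℂ H]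
    [CompleteSpace H] {T : LinearPencil H Z} (hT : ∀ x, ‖T.toeplitz x‖ ≤ ‖x‖) :
    ∃ (Y : Type u) (_ : NormedAddCommGroup Y) (_ : InnerProductSpace ℂ Y) (_ : CompleteSpace Y)
      (F : LinearPencil H Y), DenseRange F.toeplitz ∧
        ∀ x, ‖F.toeplitz x‖ ^ 2 + ‖T.toeplitz x‖ ^ 2 = ‖x‖ ^ 2 := by
  obtain ⟨E, _, _, _, R, hR, hRT⟩ :=
    exists_denseRange_adjoint_comp_self_eq (isPositive_id_sub_adjoint_comp_self hT)
  have hnorm := adjoint_comp_self_eq_id_sub_iff.1 hRT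
  obtain ⟨M, hM⟩ := exists_intertwining_linearIsometry hR hnorm
  let F := wanderingPencil M (R ∘L (lastComponent H).toContinuousLinearMap)
  have hF (x : lp (fun _ : ℕ => H) 2) : woldIsometry M (F.toeplitz x) = R x :=
    woldIsometry_toeplitz_wanderingPencil hM
      (adjoint_adjoint_apply_lastComponent_eq_zero hR hRT hM) x
  refine ⟨wanderingSubspace M, inferInstance, inferInstance, inferInstance, F, fun y => ?_,
    fun x => ?_⟩
  · have himage : woldIsometry M '' Set.range F.toeplitz = Set.range R := by
      rw [← Set.range_comp]
      exact congrArg Set.range (funext hF)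
    rw [(woldIsometry M).isometry.isUniformInducing.isInducing.closure_eq_preimage_closure_image,
      himage]
    exact hR _
  · rw [← (woldIsometry M).norm_map, hF, hnorm]

theorem exists_isOuterFactor {H : Type u} [NormedAddCommGroup H] [InnerProductSpace ℂ H]
    [CompleteSpace H] {T : LinearPencil H H} (hT : T.IsContractive) :
    ∃ (Y : Type u) (_ : NormedAddCommGroup Y) (_ : InnerProductSpace ℂ Y) (_ : CompleteSpace Y)
      (F : LinearPencil H Y), IsOuterFactor T F := by
  obtain ⟨Y, _, _, _, F, hdense, hFT⟩ :=
    exists_toeplitz_factor (LinearPencil.norm_toeplitz_apply_le hT)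
  have hcircle (ζ : ℂ) (hζ : ‖ζ‖ = 1) (h : H) :
      ‖F.eval ζ h‖ ^ 2 + ‖T.eval ζ h‖ ^ 2 = ‖h‖ ^ 2 := norm_sq_eval_add_norm_sq_eval hFT hζ h
  refine ⟨Y, inferInstance, inferInstance, inferInstance, F,
    LinearPencil.isOuter_of_denseRange_toeplitz (fun ζ hζ => ?_) hdense,
    fun ζ hζ => adjoint_comp_self_eq_id_sub_iff.2 (hcircle ζ hζ)⟩
  refine opNorm_le_bound _ zero_le_one fun h => ?_
  rw [one_mul, ← sq_le_sq₀ (norm_nonneg _) (norm_nonneg _), ← hcircle ζ hζ h]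
  exact le_add_of_nonneg_right (sq_nonneg _)

end Factorization

section Compression

namespace LinearPencil

variable {K : Type*} [NormedAddCommGroup K] [InnerProductSpace ℂ K] {S : LinearPencil K K}
  {L : Submodule ℂ K} [CompleteSpace L]

theorem compress_eval_apply (z : ℂ) (x : L) :
    (S.compress L).eval z x = L.orthogonalProjectionOnto (S.eval z x) := by
  simp [compress, eval]

theorem IsIsometric.eval_mem_of_compress (hS : S.IsIsometric) (hL : (S.compress L).IsIsometric)
    {ζ : ℂ} (hζ : ‖ζ‖ = 1) {x : K} (hx : x ∈ L) : S.eval ζ x ∈ L := by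
  have hnorm := hL ζ hζ ⟨x, hx⟩
  rw [compress_eval_apply] at hnorm
  exact (L.mem_iff_norm_starProjection _).2 (hnorm.trans (hS ζ hζ x).symm)

end LinearPencil

end Compression

section Dilation

variable {Y H : Type*} [NormedAddCommGroup H] [InnerProductSpace ℂ H]
  [NormedAddCommGroup Y] [InnerProductSpace ℂ Y]

variable (Y H) in
/-- The embedding `y ↦ col(…, y₁, y₀, 0)` of `⨁_{-∞}^{-1} Y` into `K₊`. -/
def embedPast : lp (fun _ : ℕ => Y) 2 →ₗᵢ[ℂ] KPlus Y H where
  toFun y := WithLp.toLp 2 (y, 0)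
  map_add' y y' := by rw [← WithLp.toLp_add, Prod.mk_add_mk, add_zero]
  map_smul' c y := by rw [RingHom.id_apply, ← WithLp.toLp_smul, Prod.smul_mk, smul_zero]
  norm_map' y := WithLp.norm_toLp_fst 2 (lp (fun _ : ℕ => Y) 2) H y

theorem embedPast_add_embedKPlus (y : lp (fun _ : ℕ => Y) 2) (h : H) :
    embedPast Y H y + embedKPlus Y H h = WithLp.toLp 2 (y, h) := by
  change WithLp.toLp 2 (y, 0) + WithLp.toLp 2 (0, h) = _
  rw [← WithLp.toLp_add, Prod.mk_add_mk, add_zero, zero_add]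

variable (T : LinearPencil H H) (F : LinearPencil H Y)

theorem canonicalPencil_eval_eq (z : ℂ) (x : KPlus Y H) :
    (canonicalPencil T F).eval z x =
      embedPast Y H (shift Y x.fst + lastComponent Y (F.eval z x.snd)) +
        embedKPlus Y H (T.eval z x.snd) := by
  rw [embedPast_add_embedKPlus, ← canonicalPencil_eval_fst T F, ← canonicalPencil_eval_snd T F]
  rfl

theorem canonicalPencil_eval_embedPast (z : ℂ) (y : lp (fun _ : ℕ => Y) 2) :
    (canonicalPencil T F).eval z (embedPast Y H y) = embedPast Y H (shift Y y) := by
  simp [canonicalPencil_eval_eq, embedPast]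

theorem canonicalPencil_eval_embedKPlus (z : ℂ) (h : H) :
    (canonicalPencil T F).eval z (embedKPlus Y H h) =
      embedPast Y H (lastComponent Y (F.eval z h)) + embedKPlus Y H (T.eval z h) := by
  simp [canonicalPencil_eval_eq, embedKPlus]

variable {T F}

theorem isIsometric_canonicalPencil_of_norm_sq_add_norm_sq_eq
    (hFT : ∀ ζ : ℂ, ‖ζ‖ = 1 → ∀ h, ‖F.eval ζ h‖ ^ 2 + ‖T.eval ζ h‖ ^ 2 = ‖h‖ ^ 2) :
    (canonicalPencil T F).IsIsometric := by
  intro ζ hζ x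
  rw [← sq_eq_sq₀ (norm_nonneg _) (norm_nonneg _), WithLp.prod_norm_sq_eq_of_L2,
    WithLp.prod_norm_sq_eq_of_L2, canonicalPencil_eval_fst, canonicalPencil_eval_snd,
    norm_sq_shift_add_lastComponent, add_assoc, hFT ζ hζ]

/-- An invariant subspace containing `H` absorbs `F(1) h` and `F(-1) h` in the component `-1`,
hence also their mean `F₀ h`. -/
theorem eq_top_of_canonicalPencil_eval_mem (hF : DenseRange F.coeff0)
    {L : Submodule ℂ (KPlus Y H)} (hclosed : IsClosed (L : Set (KPlus Y H)))
    (hH : ∀ h, embedKPlus Y H h ∈ L)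
    (hinv : ∀ ζ : ℂ, ‖ζ‖ = 1 → ∀ x ∈ L, (canonicalPencil T F).eval ζ x ∈ L) : L = ⊤ := by
  have heval (ζ : ℂ) (hζ : ‖ζ‖ = 1) (h : H) :
      embedPast Y H (lastComponent Y (F.eval ζ h)) ∈ L := by
    have hmem := hinv ζ hζ _ (hH h)
    rw [canonicalPencil_eval_embedKPlus] at hmem
    exact (L.add_mem_iff_left (hH _)).1 hmem
  have hcoeff0 (h : H) : embedPast Y H (lastComponent Y (F.coeff0 h)) ∈ L := by
    rw [F.coeff0_apply, map_smul, map_smul, map_add, map_add]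
    exact L.smul_mem _ (L.add_mem (heval 1 (by simp) h) (heval (-1) (by simp) h))
  have hpast : L.comap (embedPast Y H).toLinearMap = ⊤ := by
    refine eq_top_of_shift_mem_of_lastComponent_mem (hclosed.preimage (embedPast Y H).continuous)
      (fun y hy => ?_) fun c => ?_
    · have hmem := hinv 1 (by simp) _ hy
      rwa [LinearIsometry.coe_toLinearMap, canonicalPencil_eval_embedPast] at hmem
    · exact hF.induction_on (p := fun c => embedPast Y H (lastComponent Y c) ∈ L) c
        (hclosed.preimage ((embedPast Y H).continuous.comp (lastComponent Y).continuous)) hcoeff0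
  refine eq_top_iff.2 fun x _ => ?_
  have hfst : embedPast Y H x.fst ∈ L := Submodule.mem_comap.1 (hpast ▸ Submodule.mem_top)
  have hsum := L.add_mem hfst (hH x.snd)
  rw [embedPast_add_embedKPlus] at hsum
  exact hsum

section Adjoint

variable [CompleteSpace H] [CompleteSpace Y]

theorem adjoint_embedKPlus_apply (x : KPlus Y H) :
    adjoint (embedKPlus Y H).toContinuousLinearMap x = x.snd := by
  refine ext_inner_left ℂ fun h => ?_
  rw [adjoint_inner_right]
  simp [embedKPlus, WithLp.prod_inner_apply]

variable (T F) in
theorem map_eval_prod_eq_adjoint_embedKPlus (l : List ℂ) :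
    (l.map T.eval).prod = adjoint (embedKPlus Y H).toContinuousLinearMap ∘L
      (l.map (canonicalPencil T F).eval).prod ∘L (embedKPlus Y H).toContinuousLinearMap := by
  ext h
  simp only [comp_apply, adjoint_embedKPlus_apply]
  induction l with
  | nil => rfl
  | cons z l ih =>
    rw [List.map_cons, List.prod_cons, List.map_cons, List.prod_cons, mul_apply_eq_comp,
      mul_apply_eq_comp, canonicalPencil_eval_snd, ih]

variable (T F) in
theorem isUniformDilation_canonicalPencil :
    IsUniformDilation (embedKPlus Y H) T (canonicalPencil T F) := by
  refine ⟨fun ζ _ n => ?_, fun l _ => map_eval_prod_eq_adjoint_embedKPlus T F l⟩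
  simpa using map_eval_prod_eq_adjoint_embedKPlus T F (List.replicate n ζ)

theorem IsOuterFactor.isIsometric_canonicalPencil (hF : IsOuterFactor T F) :
    (canonicalPencil T F).IsIsometric :=
  isIsometric_canonicalPencil_of_norm_sq_add_norm_sq_eq fun ζ hζ =>
    adjoint_comp_self_eq_id_sub_iff.1 (hF.2 ζ hζ)

theorem IsOuterFactor.eq_top_of_isIsometric_compress (hF : IsOuterFactor T F)
    {L : Submodule ℂ (KPlus Y H)} [CompleteSpace L] (hH : ∀ h, embedKPlus Y H h ∈ L)
    (hL : ((canonicalPencil T F).compress L).IsIsometric) : L = ⊤ :=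
  eq_top_of_canonicalPencil_eval_mem (F.eval_zero ▸ hF.1.denseRange_apply_zero)
    (completeSpace_coe_iff_isComplete.1 ‹_›).isClosed hH
    fun _ hζ _ hx => hF.isIsometric_canonicalPencil.eval_mem_of_compress hL hζ hx

end Adjoint

end Dilation

theorem mainTheorem1_general {H : Type u} [NormedAddCommGroup H] [InnerProductSpace ℂ H]
    [CompleteSpace H] (T : LinearPencil H H) (hT : T.IsContractive) :
    (∃ (Y : Type u) (_ : NormedAddCommGroup Y) (_ : InnerProductSpace ℂ Y)
        (_ : CompleteSpace Y) (F : LinearPencil H Y), IsOuterFactor T F) ∧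
    ∀ (Y : Type v) [NormedAddCommGroup Y] [InnerProductSpace ℂ Y] [CompleteSpace Y]
      (F : LinearPencil H Y), IsOuterFactor T F →
      IsMinimalIsometricDilation (embedKPlus Y H) T (canonicalPencil T F) ∧
      IsMinimalUniformIsometricDilation (embedKPlus Y H) T (canonicalPencil T F) := by
  refine ⟨exists_isOuterFactor hT, fun Y _ _ _ F hF => ?_⟩
  have hisometric := hF.isIsometric_canonicalPencil
  have hdilation := isUniformDilation_canonicalPencil T F
  refine ⟨⟨⟨hT, hisometric, hdilation.1⟩, fun L _ κ hκ hL => ?_⟩,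
    ⟨hT, hisometric, hdilation⟩, fun L _ κ hκ hL => ?_⟩ <;>
  exact hF.eq_top_of_isIsometric_compress (fun h => hκ h ▸ (κ h).2) hL.2.1

end

theorem mainTheorem1 {H : Type u} [NormedAddCommGroup H] [InnerProductSpace ℂ H]
    [CompleteSpace H] [TopologicalSpace.SeparableSpace H]
    (T : LinearPencil H H) (hT : T.IsContractive) :
    (∃ (Y : Type u) (_ : NormedAddCommGroup Y) (_ : InnerProductSpace ℂ Y)
        (_ : CompleteSpace Y) (_ : TopologicalSpace.SeparableSpace Y) (F : LinearPencil H Y),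
        IsOuterFactor T F) ∧
    ∀ (Y : Type v) [NormedAddCommGroup Y] [InnerProductSpace ℂ Y] [CompleteSpace Y]
      [TopologicalSpace.SeparableSpace Y] (F : LinearPencil H Y), IsOuterFactor T F →
      IsMinimalIsometricDilation (embedKPlus Y H) T (canonicalPencil T F) ∧
      IsMinimalUniformIsometricDilation (embedKPlus Y H) T (canonicalPencil T F) := by
  obtain ⟨⟨Y, _, _, _, F, hF⟩, hminimal⟩ := mainTheorem1_general T hT
  have hY := hF.1.denseRange_apply_zero.separableSpace (F.eval 0).continuous
  exact ⟨⟨Y, _, _, _, hY, F, hF⟩, fun Y _ _ _ _ F hF => hminimal Y F hF⟩
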